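/- Let $k,n\ge 0$ be integers and write $[m]=\{1,\dots,m\}$. A standard Young tableau of shape $\mu\vdash m$ is a filling of the cells of the Young diagram of $\mu$ by $1,\dots,m$, each used exactly once, increasing along rows (left to right) and down columns (top to bottom). For partitions $\mu\subseteq\lambda$, $\lambda/\mu$ is a horizontal strip if no two distinct cells of $\lambda$ outside $\mu$ lie in the same column. Encode an injection $f:[k]\to[n]$, $f(i)=j_i$, as the generalized permutation $$w_f=\begin{pmatrix}1&2&\cdots&k&k+1&\cdots&k+1\\ j_1&j_2&\cdots&j_k&j_{k+1}&\cdots&j_n\end{pmatrix},$$ where $j_{k+1}<\cdots<j_n$ are the elements of $[n]\setminus\{j_1,\dots,j_k\}$. Apply the Robinson–Schensted–Knuth (RSK) algorithm to $w_f$: start from two empty tableaux and read the columns $\binom{i}{j}$ of $w_f$ from left to right; row-insert $j$ into the first tableau ($j$ replaces the leftmost entry greater than $j$ in the first row, the replaced entry is inserted in the same way into the next row, and so on, until an entry is placed at the end of a row), and add to the second tableau a cell with label $i$ at the position of the cell just created in the first. Let $(P_f,\widehat Q_f)$ be the resulting pair (insertion tableau, recording tableau). Theorem. For every injection $f:[k]\to[n]$,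 $P_f$ is a standard Young tableau of some shape $\lambda\vdash n$; $\widehat Q_f$ is a semistandard Young tableau (rows weakly increasing, columns strictly increasing) of the same shape $\lambda$; and removing from $\widehat Q_f$ the cells labelled $k+1$ leaves a standard Young tableau $Q_f$ of some shape $\mu\vdash k$ such that $\lambda/\mu$ is a horizontal strip. Moreover, $f\mapsto(P_f,Q_f)$ is a bijection from the set $S_{k,n}$ of injections $[k]\to[n]$ onto the set of all pairs $(P,Q)$ where $P$ is a standard Young tableau of shape $\lambda\vdash n$ and $Q$ is a standard Young tableau of shape $\mu\vdash k$ such that $\lambda/\mu$ is a horizontal strip. -/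

import Mathlib

namespace InjRSK

/-- A standard Young tableau of shape `μ`: a filling of the cells of `μ` by `1, …, |μ|`, each
number being used exactly once, with rows increasing from left to right and columns increasing
from top to bottom. As for Mathlib's `SemistandardYoungTableau`, the filling is a function on
all of `ℕ × ℕ` that vanishes outside `μ`. -/
@[ext]
structure StandardYoungTableau (μ : YoungDiagram) where
  entry : ℕ → ℕ → ℕ
  bijOn : Set.BijOn (fun c : ℕ × ℕ => entry c.1 c.2) (μ : Set (ℕ × ℕ)) (Set.Icc 1 μ.card)
  row_strict : ∀ {i j₁ j₂ : ℕ}, j₁ < j₂ → (i, j₂) ∈ μ → entry i j₁ < entry i j₂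
  col_strict : ∀ {i₁ i₂ j : ℕ}, i₁ < i₂ → (i₂, j) ∈ μ → entry i₁ j < entry i₂ j
  zeros : ∀ {i j : ℕ}, (i, j) ∉ μ → entry i j = 0

/-- `lam / mu` is a horizontal strip: `mu` is contained in `lam`, and no two distinct cells of
`lam` outside `mu` lie in the same column. -/
def IsHorizontalStrip (lam mu : YoungDiagram) : Prop :=
  mu ≤ lam ∧ ∀ i₁ i₂ j : ℕ, (i₁, j) ∈ lam → (i₁, j) ∉ mu → (i₂, j) ∈ lam → (i₂, j) ∉ mu → i₁ = i₂

/-- Pairs `(P, Q)` of standard Young tableaux, `P` of shape `lam ⊢ n` and `Q` of shape `mu ⊢ k`,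
such that `lam / mu` is a horizontal strip. -/
structure TableauPair (k n : ℕ) where
  lam : YoungDiagram
  mu : YoungDiagram
  card_lam : lam.card = n
  card_mu : mu.card = k
  strip : IsHorizontalStrip lam mu
  P : StandardYoungTableau lam
  Q : StandardYoungTableau mu

/-- The filling `t` of the cells of `μ`, written as the list of its (nonempty) rows. -/
def rowsOf (μ : YoungDiagram) (t : ℕ → ℕ → ℕ) : List (List ℕ) :=
  (List.range (μ.colLen 0)).map fun i => (List.range (μ.rowLen i)).map fun j => t i j

/-- A generalized permutation: a two-line array, here the list of its columns
`(i_r, j_r)`, whose columns are in lexicographic order. -/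
structure GeneralizedPermutation where
  columns : List (ℕ × ℕ)
  sorted : columns.Pairwise fun a b => a.1 ≤ b.1 ∧ (a.1 = b.1 → a.2 ≤ b.2)

/-- Insertion of `x` into a weakly increasing row: `x` replaces the leftmost entry greater than
`x`, which is bumped (returned as the second component), or is put at the end of the row if there
is no such entry. -/
def rowInsert (x : ℕ) : List ℕ → List ℕ × Option ℕ
  | [] => ([x], none)
  | y :: r =>
    if x < y then (x :: r, some y)
    else (y :: (rowInsert x r).1, (rowInsert x r).2)

/-- Row insertion of `x` into a tableau (a list of rows): `x` is inserted into the first row, the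
bumped entry into the second row, and so on. The second component is the index of the row
at whose end the new cell appears. -/
def tableauInsert (x : ℕ) : List (List ℕ) → List (List ℕ) × ℕ
  | [] => ([[x]], 0)
  | r :: T =>
    match rowInsert x r with
    | (r', none) => (r' :: T, 0)
    | (r', some y) => (r' :: (tableauInsert y T).1, (tableauInsert y T).2 + 1)

/-- Add a cell with label `a` at the end of the row of index `i` (a new row if `i` is the number
of rows; larger `i` do not occur in the algorithm). -/
def addCell (a : ℕ) : ℕ → List (List ℕ) → List (List ℕ)
  | _, [] => [[a]]
  | 0, r :: T => (r ++ [a]) :: T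
  | i + 1, r :: T => r :: addCell a i T

/-- The Robinson-Schensted-Knuth algorithm, with output (insertion tableau, recording tableau):
starting with two empty tableaux, the columns `(i, j)` are read from left to right;
`j` is inserted into the first tableau and the cell created is added to the second tableau,
with label `i`. -/
def rsk (w : GeneralizedPermutation) : List (List ℕ) × List (List ℕ) :=
  w.columns.foldl
    (fun PQ c => ((tableauInsert c.2 PQ.1).1, addCell c.1 (tableauInsert c.2 PQ.1).2 PQ.2))
    ([], [])

/-- The elements of `Fin n` that are not values of `f`, from least to greatest. -/
def missing {k n : ℕ} (f : Fin k ↪ Fin n) : List (Fin n) :=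
  (List.finRange n).filter fun j => ∀ i, f i ≠ j

/-- The generalized permutation with columns
`(1, j_1), …, (k, j_k), (k+1, j_{k+1}), …, (k+1, j_n)` that encodes an injection `i ↦ j_i` from
`[k]` to `[n]`; `j_{k+1} < ⋯ < j_n` are the elements of `[n]` which are not values of
the injection. Here `[n]` is modelled by `Fin n`, its elements being shifted by one. -/
def encode {k n : ℕ} (f : Fin k ↪ Fin n) : GeneralizedPermutation where
  columns :=
    (List.finRange k).map (fun i : Fin k => ((i : ℕ) + 1, (f i : ℕ) + 1)) ++
      (missing f).map (fun j : Fin n => (k + 1, (j : ℕ) + 1))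
  sorted := by
    rw [List.pairwise_append]
    refine ⟨?_, ?_, ?_⟩
    · rw [List.pairwise_map]
      refine (List.pairwise_lt_finRange k).imp ?_
      intro a b hab
      have h : (a : ℕ) < b := hab
      exact ⟨by simp only; omega, fun h' => by simp only at h'; omega⟩
    · rw [List.pairwise_map]
      refine ((List.pairwise_lt_finRange n).filter _).imp ?_
      intro a b hab
      have h : (a : ℕ) < b := hab
      exact ⟨le_refl _, fun _ => by simp only; omega⟩
    · intro a ha b hb
      simp only [List.mem_map] at ha hb
      obtain ⟨i, _, rfl⟩ := ha
      obtain ⟨j, _, rfl⟩ := hb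
      have h := i.isLt
      exact ⟨by simp only; omega, fun h' => by simp only at h'; omega⟩

end InjRSK

namespace InjRSK

/-! ### Semistandard tableaux as lists of rows -/

/-- The rows `R` and `S`, placed below each other, have strictly increasing columns. -/
def Dominates : List ℕ → List ℕ → Prop
  | _, [] => True
  | [], _ :: _ => False
  | a :: R, b :: S => a < b ∧ Dominates R S

/-- A list of rows that form a semistandard tableau. -/
def IsTableau : List (List ℕ) → Prop
  | [] => True
  | R :: T => R ≠ [] ∧ R.Pairwise (· ≤ ·) ∧ Dominates R (T.headD []) ∧ IsTableau T

@[simp] lemma dominates_nil (R : List ℕ) : Dominates R [] := by cases R <;> trivial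

@[simp] lemma not_dominates_cons (b : ℕ) (S : List ℕ) : ¬ Dominates [] (b :: S) := id

@[simp] lemma dominates_cons (a b : ℕ) (R S : List ℕ) :
    Dominates (a :: R) (b :: S) ↔ a < b ∧ Dominates R S := Iff.rfl

@[simp] lemma isTableau_nil : IsTableau [] := trivial

@[simp] lemma isTableau_cons (R : List ℕ) (T : List (List ℕ)) : IsTableau (R :: T) ↔
    R ≠ [] ∧ R.Pairwise (· ≤ ·) ∧ Dominates R (T.headD []) ∧ IsTableau T := Iff.rfl

lemma Dominates.length_le {R S : List ℕ} (h : Dominates R S) : S.length ≤ R.length := by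
  induction R generalizing S with
  | nil => cases S <;> simp_all
  | cons a R ih =>
    cases S with
    | nil => simp
    | cons b S => simpa using ih h.2

lemma Dominates.append {R S : List ℕ} (h : Dominates R S) (U : List ℕ) :
    Dominates (R ++ U) S := by
  induction R generalizing S with
  | nil => cases S <;> simp_all
  | cons a R ih =>
    cases S with
    | nil => simp
    | cons b S => exact ⟨h.1, ih h.2⟩

lemma Dominates.of_append {R S U : List ℕ} (h : Dominates (R ++ U) S)
    (hl : S.length ≤ R.length) : Dominates R S := by
  induction R generalizing S with
  | nil => cases S <;> simp_all
  | cons a R ih =>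
    cases S with
    | nil => simp
    | cons b S => exact ⟨h.1, ih h.2 (by simpa using hl)⟩

/-- An entry of `S` below `m` would have to exceed `m`; so nothing lies below `m`, and its cell can
be removed. -/
lemma Dominates.of_concat {R S : List ℕ} {m : ℕ} (h : Dominates (R ++ [m]) S)
    (hm : ∀ b ∈ S, b ≤ m) : Dominates R S := by
  induction R generalizing S with
  | nil =>
    cases S with
    | nil => simp
    | cons b S =>
      have := hm b (by simp)
      have := h.1
      omega
  | cons a R ih =>
    cases S with
    | nil => simp
    | cons b S => exact ⟨h.1, ih h.2 fun c hc => hm c (by simp [hc])⟩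

lemma Dominates.concat {R S : List ℕ} {m : ℕ} (h : Dominates R S)
    (hm : ∀ b ∈ R, b < m) (hl : S.length < R.length) : Dominates R (S ++ [m]) := by
  induction R generalizing S with
  | nil => simp at hl
  | cons a R ih =>
    cases S with
    | nil => simpa using hm a (by simp)
    | cons b S =>
      exact ⟨h.1, ih h.2 (fun c hc => hm c (by simp [hc])) (by simpa using hl)⟩

lemma Dominates.of_concat_right {R S : List ℕ} {m : ℕ} (h : Dominates R (S ++ [m])) :
    Dominates R S := by
  induction R generalizing S with
  | nil => cases S <;> simp_all
  | cons a R ih =>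
    cases S with
    | nil => simp
    | cons b S => exact ⟨h.1, ih h.2⟩

/-! ### Row insertion -/

lemma mem_rowInsert (x : ℕ) (R : List ℕ) : x ∈ (rowInsert x R).1 := by
  induction R with
  | nil => simp [rowInsert]
  | cons a R ih => unfold rowInsert; split_ifs <;> simp [ih]

lemma mem_of_mem_rowInsert {x z : ℕ} {R : List ℕ} (h : z ∈ (rowInsert x R).1) :
    z = x ∨ z ∈ R := by
  induction R with
  | nil => simpa [rowInsert] using h
  | cons a R ih =>
    unfold rowInsert at h
    split_ifs at h <;> simp only [List.mem_cons] at h ⊢ <;> tauto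

lemma lt_of_rowInsert_eq_some {x y : ℕ} {R : List ℕ} (h : (rowInsert x R).2 = some y) :
    x < y ∧ y ∈ R := by
  induction R with
  | nil => simp [rowInsert] at h
  | cons a R ih =>
    unfold rowInsert at h
    split_ifs at h with hx
    · simp only [Option.some.injEq] at h
      subst h
      simp [hx]
    · have := ih h
      simp [this]

lemma rowInsert_of_eq_none {x : ℕ} {R : List ℕ} (h : (rowInsert x R).2 = none) :
    (rowInsert x R).1 = R ++ [x] := by
  induction R with
  | nil => simp [rowInsert]
  | cons a R ih =>
    unfold rowInsert at h ⊢
    split_ifs at h ⊢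
    simp [ih h]

lemma rowInsert_of_forall_le {x : ℕ} {R : List ℕ} (h : ∀ b ∈ R, b ≤ x) :
    rowInsert x R = (R ++ [x], none) := by
  induction R with
  | nil => simp [rowInsert]
  | cons a R ih =>
    have h1 : ¬ x < a := by simpa using h a (by simp)
    simp [rowInsert, h1, ih fun b hb => h b (by simp [hb])]

lemma rowInsert_length_of_eq_some {x y : ℕ} {R : List ℕ} (h : (rowInsert x R).2 = some y) :
    (rowInsert x R).1.length = R.length := by
  induction R with
  | nil => simp [rowInsert] at h
  | cons a R ih =>
    unfold rowInsert at h ⊢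
    split_ifs at h ⊢
    · simp
    · simp [ih h]

lemma rowInsert_ne_nil (x : ℕ) (R : List ℕ) : (rowInsert x R).1 ≠ [] :=
  List.ne_nil_of_mem (mem_rowInsert x R)

lemma rowInsert_perm (x : ℕ) (R : List ℕ) :
    ((rowInsert x R).1 ++ (rowInsert x R).2.toList).Perm (x :: R) := by
  induction R with
  | nil => simp [rowInsert]
  | cons a R ih =>
    unfold rowInsert
    split_ifs
    · simp only [Option.toList_some, List.cons_append]
      exact List.Perm.cons _ (List.perm_append_comm)
    · exact (ih.cons a).trans (List.Perm.swap _ _ _)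

lemma rowInsert_pairwise {x : ℕ} {R : List ℕ} (h : R.Pairwise (· ≤ ·)) :
    (rowInsert x R).1.Pairwise (· ≤ ·) := by
  induction R with
  | nil => simp [rowInsert]
  | cons a R ih =>
    rw [List.pairwise_cons] at h
    unfold rowInsert
    split_ifs with hx
    · rw [List.pairwise_cons]
      exact ⟨fun b hb => hx.le.trans (h.1 b hb), h.2⟩
    · rw [List.pairwise_cons]
      refine ⟨fun b hb => ?_, ih h.2⟩
      rcases mem_of_mem_rowInsert hb with rfl | hb
      · omega
      · exact h.1 b hb

lemma exists_rowInsert_eq_cons (x : ℕ) (R : List ℕ) :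
    ∃ z S, (rowInsert x R).1 = z :: S ∧ z ≤ x := by
  cases R with
  | nil => exact ⟨x, [], rfl, le_rfl⟩
  | cons a R =>
    unfold rowInsert
    split_ifs with hx
    · exact ⟨x, R, rfl, le_rfl⟩
    · exact ⟨a, _, rfl, by omega⟩

lemma rowInsert_injective {x x' : ℕ} {R R' : List ℕ} (hR : R.Pairwise (· ≤ ·))
    (hR' : R'.Pairwise (· ≤ ·)) (h : rowInsert x R = rowInsert x' R') : x = x' ∧ R = R' := by
  induction R generalizing R' with
  | nil =>
    cases R' with
    | nil => simpa [rowInsert] using h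
    | cons a R' =>
      exfalso
      unfold rowInsert at h
      split_ifs at h
      · simp at h
      · simp only [Prod.mk.injEq, List.cons.injEq] at h
        exact rowInsert_ne_nil _ _ h.1.2.symm
  | cons a R ih =>
    rw [List.pairwise_cons] at hR
    cases R' with
    | nil =>
      exfalso
      unfold rowInsert at h
      split_ifs at h
      · simp at h
      · simp only [Prod.mk.injEq, List.cons.injEq] at h
        exact rowInsert_ne_nil _ _ h.1.2
    | cons a' R' =>
      rw [List.pairwise_cons] at hR'
      unfold rowInsert at h
      split_ifs at h with h1 h2 h2
      · simp only [Prod.mk.injEq, List.cons.injEq, Option.some.injEq] at h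
        simp [h]
      -- One row changed at its head, the other further right: the bumped entry `a` exceeds `x'`,
      -- but `x'` lies in the tail `R` of the sorted row `a :: R`, so `a ≤ x'`. The next case is
      -- symmetric.
      · simp only [Prod.mk.injEq, List.cons.injEq] at h
        have h3 := lt_of_rowInsert_eq_some h.2.symm
        have h4 := hR.1 x' (h.1.2 ▸ mem_rowInsert x' R')
        omega
      · simp only [Prod.mk.injEq, List.cons.injEq] at h
        have h3 := lt_of_rowInsert_eq_some h.2
        have h4 := hR'.1 x (h.1.2 ▸ mem_rowInsert x R)
        omega
      · simp only [Prod.mk.injEq, List.cons.injEq] at h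
        obtain ⟨h3, h4⟩ := ih hR.2 hR'.2 (Prod.ext h.1.2 h.2)
        exact ⟨h3, by rw [h.1.1, h4]⟩

/-- Every bumping of an entry `y` out of a row can be reversed. -/
lemma exists_rowInsert_eq_some {a y : ℕ} {R : List ℕ} (hR : (a :: R).Pairwise (· ≤ ·))
    (hy : a < y) : ∃ x S, S.Pairwise (· ≤ ·) ∧ a ≤ x ∧ (∀ b ∈ S, a ≤ b) ∧
      rowInsert x S = (a :: R, some y) := by
  induction R generalizing a with
  | nil => exact ⟨a, [y], by simp, le_rfl, by simpa using hy.le, by simp [rowInsert, hy]⟩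
  | cons b R ih =>
    have hR' := hR
    rw [List.pairwise_cons] at hR
    -- The entry to eject is the rightmost one less than `y`, and `y` takes its place.
    by_cases hb : b < y
    · obtain ⟨x, S, hS, hx, hS', h⟩ := ih hR.2 hb
      have hab := hR.1 b (by simp)
      refine ⟨x, a :: S, ?_, hab.trans hx, ?_, ?_⟩
      · rw [List.pairwise_cons]
        exact ⟨fun c hc => hab.trans (hS' c hc), hS⟩
      · simp only [List.mem_cons, forall_eq_or_imp, le_refl, true_and]
        exact fun c hc => hab.trans (hS' c hc)
      · have : ¬ x < a := by omega
        simp [rowInsert, this, h]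
    · have h1 : ∀ c ∈ b :: R, y ≤ c := by
        intro c hc
        have h2 := hR.2
        rw [List.pairwise_cons] at h2
        rcases List.mem_cons.1 hc with rfl | hc
        · omega
        · have := h2.1 c hc
          omega
      refine ⟨a, y :: b :: R, List.pairwise_cons.2 ⟨h1, hR.2⟩, le_rfl, ?_, by simp [rowInsert, hy]⟩
      simp only [List.mem_cons, forall_eq_or_imp]
      exact ⟨hy.le, hR.1 b (by simp), fun c hc => hR.1 c (by simp [hc])⟩

lemma Dominates.rowInsert_left {x : ℕ} {R S : List ℕ} (h : Dominates R S) :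
    Dominates (rowInsert x R).1 S := by
  induction R generalizing S with
  | nil => cases S <;> simp_all
  | cons a R ih =>
    cases S with
    | nil => simp
    | cons b S =>
      unfold rowInsert
      split_ifs with hx
      · exact ⟨hx.trans h.1, h.2⟩
      · exact ⟨h.1, ih h.2⟩

/-- The entry below the old place of `y`, if any, exceeds `y`, so `y` lands in the next row weakly
to the left of that place. The entry then above it is at most `x`, hence less than `y`. -/
lemma Dominates.rowInsert {x y : ℕ} {R S : List ℕ} (h : Dominates R S)
    (hy : (rowInsert x R).2 = some y) :
    Dominates (rowInsert x R).1 (rowInsert y S).1 := by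
  induction R generalizing S with
  | nil => simp [InjRSK.rowInsert] at hy
  | cons a R ih =>
    unfold InjRSK.rowInsert at hy
    rw [InjRSK.rowInsert]
    split_ifs at hy ⊢ with hx
    · simp only [Option.some.injEq] at hy
      subst hy
      cases S with
      | nil => simpa [InjRSK.rowInsert] using hx
      | cons b S => simpa [InjRSK.rowInsert, h.1, hx] using h.2
    · have h1 := lt_of_rowInsert_eq_some hy
      cases S with
      | nil =>
        simp only [InjRSK.rowInsert, dominates_cons, dominates_nil, and_true]
        omega
      | cons b S =>
        rw [InjRSK.rowInsert]
        split_ifs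
        · exact ⟨by omega, h.2.rowInsert_left⟩
        · exact ⟨h.1, ih h.2 hy⟩

/-- Undoing the bump changes only the cell that held `y`, and `y` is less than anything that can lie
below it. -/
lemma Dominates.of_rowInsert_left {x y : ℕ} {R S : List ℕ}
    (h : Dominates (InjRSK.rowInsert x R).1 S)
    (hy : (InjRSK.rowInsert x R).2 = some y) (hS : ∀ b ∈ S, y < b) : Dominates R S := by
  induction R generalizing S with
  | nil => simp [InjRSK.rowInsert] at hy
  | cons a R ih =>
    cases S with
    | nil => simp
    | cons b S =>
      unfold InjRSK.rowInsert at h hy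
      split_ifs at h hy with hx
      · simp only [Option.some.injEq] at hy
        subst hy
        exact ⟨hS b (by simp), h.2⟩
      · exact ⟨h.1, ih h.2 hy fun c hc => hS c (by simp [hc])⟩

lemma Dominates.of_rowInsert {x y : ℕ} {R S : List ℕ} (hR : R.Pairwise (· ≤ ·))
    (hS : S.Pairwise (· ≤ ·)) (hy : (InjRSK.rowInsert x R).2 = some y)
    (h : Dominates (InjRSK.rowInsert x R).1 (InjRSK.rowInsert y S).1) : Dominates R S := by
  induction R generalizing S with
  | nil => simp [InjRSK.rowInsert] at hy
  | cons a R ih =>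
    cases S with
    | nil => simp
    | cons b S =>
      rw [List.pairwise_cons] at hR hS
      unfold InjRSK.rowInsert at hy h
      split_ifs at hy h with hx hyb hyb
      · simp only [Option.some.injEq] at hy
        subst hy
        exact ⟨hyb, h.2⟩
      · simp only [Option.some.injEq] at hy
        subst hy
        -- Here `y = a` left the first column but passed over `b`, so the second row now has in its
        -- second column an entry at most `a`. The entry above that one is at least `a`.
        exfalso
        obtain ⟨z, U, hU, hz⟩ := exists_rowInsert_eq_cons a S
        have h2 := h.2
        rw [hU] at h2
        cases R with
        | nil => exact h2
        | cons c R =>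
          have := hR.1 c (by simp)
          have := h2.1
          omega
      · have h1 := lt_of_rowInsert_eq_some hy
        -- `y` replaced `b`, so all later entries of the sorted row below exceed `y`.
        refine ⟨by omega, Dominates.of_rowInsert_left h.2 hy fun c hc => ?_⟩
        have := hS.1 c hc
        omega
      · exact ⟨h.1, ih hR.2 hS.2 hy h.2⟩

/-- `x'` passes over `x` and everything to its left, so it bumps from further right in a sorted row.
If `x` was put at the end, `x'` bumps nothing. -/
lemma bumped_le_of_le {x x' y' : ℕ} {R : List ℕ} (hR : R.Pairwise (· ≤ ·)) (hx : x ≤ x')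
    (h : (rowInsert x' (rowInsert x R).1).2 = some y') :
    ∃ y, (rowInsert x R).2 = some y ∧ y ≤ y' := by
  induction R with
  | nil =>
    have : ¬ x' < x := by omega
    simp [rowInsert, this] at h
  | cons a R ih =>
    rw [List.pairwise_cons] at hR
    rw [rowInsert.eq_2 x] at h ⊢
    split_ifs at h ⊢ with h1
    · have : ¬ x' < x := by omega
      simp only [rowInsert, this, if_false] at h
      exact ⟨a, rfl, hR.1 _ (lt_of_rowInsert_eq_some h).2⟩
    · have : ¬ x' < a := by omega
      simp only [rowInsert, this, if_false] at h
      exact ih hR.2 h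

/-- After the first insertion `x` is in the row and exceeds `x'`, so `x'` bumps `x` or an entry to
its left. These are at most `x`, hence less than whatever `x` bumped. -/
lemma bumped_lt_of_lt {x x' : ℕ} (R : List ℕ) (hx : x' < x) :
    ∃ y', (rowInsert x' (rowInsert x R).1).2 = some y' ∧
      ∀ y, (rowInsert x R).2 = some y → y' < y := by
  induction R with
  | nil => exact ⟨x, by simp [rowInsert, hx], by simp [rowInsert]⟩
  | cons a R ih =>
    rw [rowInsert.eq_2 x]
    split_ifs with h1
    · exact ⟨x, by simp [rowInsert, hx], by simp [h1]⟩
    · rw [rowInsert.eq_2 x']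
      split_ifs
      · refine ⟨a, rfl, fun y hy => ?_⟩
        have := lt_of_rowInsert_eq_some hy
        omega
      · exact ih

/-! ### Tableau insertion -/

lemma tableauInsert_cons_of_none {x : ℕ} {R : List ℕ} (T : List (List ℕ))
    (h : (rowInsert x R).2 = none) : tableauInsert x (R :: T) = ((R ++ [x]) :: T, 0) := by
  have h1 : rowInsert x R = (R ++ [x], none) := Prod.ext (rowInsert_of_eq_none h) h
  simp [tableauInsert, h1]

lemma tableauInsert_cons_of_some {x y : ℕ} {R : List ℕ} (T : List (List ℕ))
    (h : (rowInsert x R).2 = some y) : tableauInsert x (R :: T) =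
      ((rowInsert x R).1 :: (tableauInsert y T).1, (tableauInsert y T).2 + 1) := by
  have h1 : rowInsert x R = ((rowInsert x R).1, some y) := Prod.ext rfl h
  rw [tableauInsert, h1]

/-- The default `[]` treats a missing row as an empty one, so that starting a new row is a case of
row insertion. -/
lemma headD_tableauInsert (x : ℕ) (T : List (List ℕ)) :
    (tableauInsert x T).1.headD [] = (rowInsert x (T.headD [])).1 := by
  cases T with
  | nil => rfl
  | cons R T =>
    rcases h : (rowInsert x R).2 with _ | y
    · simp [tableauInsert_cons_of_none T h, rowInsert_of_eq_none h]
    · simp [tableauInsert_cons_of_some T h]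

lemma IsTableau.pairwise_headD {T : List (List ℕ)} (h : IsTableau T) :
    (T.headD []).Pairwise (· ≤ ·) := by
  cases T with
  | nil => simp
  | cons R T => exact h.2.1

lemma IsTableau.tableauInsert {T : List (List ℕ)} (h : IsTableau T) (x : ℕ) :
    IsTableau (tableauInsert x T).1 := by
  induction T generalizing x with
  | nil => simp [InjRSK.tableauInsert]
  | cons R T ih =>
    obtain ⟨h1, h2, h3, h4⟩ := h
    have h5 := rowInsert_pairwise (x := x) h2
    rcases h : (rowInsert x R).2 with _ | y
    · rw [tableauInsert_cons_of_none T h]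
      exact ⟨by simp, rowInsert_of_eq_none h ▸ h5, h3.append _, h4⟩
    · rw [tableauInsert_cons_of_some T h]
      refine ⟨rowInsert_ne_nil _ _, h5, ?_, ih h4 y⟩
      rw [headD_tableauInsert]
      exact h3.rowInsert h

lemma tableauInsert_perm (x : ℕ) (T : List (List ℕ)) :
    (tableauInsert x T).1.flatten.Perm (x :: T.flatten) := by
  induction T generalizing x with
  | nil => simp [tableauInsert]
  | cons R T ih =>
    have h5 := rowInsert_perm x R
    rcases h : (rowInsert x R).2 with _ | y
    · rw [tableauInsert_cons_of_none T h]
      simp only [List.flatten_cons]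
      rw [← List.cons_append]
      exact (List.perm_append_singleton x R).append_right _
    · rw [tableauInsert_cons_of_some T h]
      rw [h] at h5
      simp only [List.flatten_cons]
      refine ((ih y).append_left _).trans ?_
      have := h5.append_right T.flatten
      simpa using this

lemma tableauInsert_snd_le (x : ℕ) (T : List (List ℕ)) :
    (tableauInsert x T).2 ≤ T.length := by
  induction T generalizing x with
  | nil => simp [tableauInsert]
  | cons R T ih =>
    rcases h : (rowInsert x R).2 with _ | y
    · simp [tableauInsert_cons_of_none T h]
    · simpa [tableauInsert_cons_of_some T h] using ih y

lemma tableauInsert_cons_ne {x x' : ℕ} {R : List ℕ} (T : List (List ℕ)) (hR : R ≠ []) :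
    tableauInsert x (R :: T) ≠ tableauInsert x' [] := by
  rw [tableauInsert.eq_1 x']
  rcases hy : (rowInsert x R).2 with _ | y
  · rw [tableauInsert_cons_of_none T hy]
    intro h
    have h1 := congrArg (fun p => (p.1.headD []).length) h
    simp at h1
    exact hR h1
  · rw [tableauInsert_cons_of_some T hy]
    simp

/-- The row index tells how to undo the insertion. For index 0 the letter ends the first row;
otherwise the bumped entry and the lower rows are recovered first, then the first row by
`rowInsert_injective`. -/
lemma tableauInsert_injective {x x' : ℕ} {T T' : List (List ℕ)} (hT : IsTableau T)
    (hT' : IsTableau T') (h : tableauInsert x T = tableauInsert x' T') : x = x' ∧ T = T' := by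
  induction T generalizing x x' T' with
  | nil =>
    cases T' with
    | nil => simpa [tableauInsert] using h
    | cons R T => exact absurd h.symm (tableauInsert_cons_ne T hT'.1)
  | cons R T ih =>
    cases T' with
    | nil => exact absurd h (tableauInsert_cons_ne T hT.1)
    | cons R' T' =>
      rcases hy : (rowInsert x R).2 with _ | y <;> rcases hy' : (rowInsert x' R').2 with _ | y'
      · rw [tableauInsert_cons_of_none T hy, tableauInsert_cons_of_none T' hy'] at h
        simp only [Prod.mk.injEq, List.cons.injEq, and_true] at h
        have h1 := List.append_inj' h.1 rfl
        simpa [h1.1, h.2] using h1.2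
      · rw [tableauInsert_cons_of_none T hy, tableauInsert_cons_of_some T' hy'] at h
        simp at h
      · rw [tableauInsert_cons_of_some T hy, tableauInsert_cons_of_none T' hy'] at h
        simp at h
      · rw [tableauInsert_cons_of_some T hy, tableauInsert_cons_of_some T' hy'] at h
        simp only [Prod.mk.injEq, List.cons.injEq, Nat.add_right_cancel_iff] at h
        obtain ⟨rfl, rfl⟩ := ih hT.2.2.2 hT'.2.2.2 (Prod.ext h.1.2 h.2)
        obtain ⟨rfl, rfl⟩ := rowInsert_injective hT.2.1 hT'.2.1
          (Prod.ext h.1.1 (hy.trans hy'.symm))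
        simp

/-- The row bumping lemma: inserting weakly increasing letters, the new cells move weakly up. -/
lemma tableauInsert_snd_le_of_le {x x' : ℕ} {T : List (List ℕ)} (hT : IsTableau T)
    (hx : x ≤ x') :
    (tableauInsert x' (tableauInsert x T).1).2 ≤ (tableauInsert x T).2 := by
  induction T generalizing x x' with
  | nil =>
    have h1 : (rowInsert x' [x]).2 = none := by
      rw [rowInsert_of_forall_le (by simpa using hx)]
    simp [tableauInsert, tableauInsert_cons_of_none [] h1]
  | cons R T ih =>
    rcases hy : (rowInsert x' (rowInsert x R).1).2 with _ | y'
    · rcases h1 : (rowInsert x R).2 with _ | y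
      · rw [tableauInsert_cons_of_none T h1, ← rowInsert_of_eq_none h1,
          tableauInsert_cons_of_none T hy]
      · rw [tableauInsert_cons_of_some T h1, tableauInsert_cons_of_none _ hy]
        simp
    · obtain ⟨y, h1, h2⟩ := bumped_le_of_le hT.2.1 hx hy
      rw [tableauInsert_cons_of_some T h1, tableauInsert_cons_of_some _ hy]
      simpa using ih hT.2.2.2 h2

/-- The row bumping lemma: inserting strictly decreasing letters, the new cells move
strictly down. -/
lemma tableauInsert_snd_lt_of_lt {x x' : ℕ} (T : List (List ℕ)) (hx : x' < x) :
    (tableauInsert x T).2 < (tableauInsert x' (tableauInsert x T).1).2 := by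
  induction T generalizing x x' with
  | nil => simp [tableauInsert, rowInsert, hx]
  | cons R T ih =>
    obtain ⟨y', h1, h2⟩ := bumped_lt_of_lt R hx
    rcases hy : (rowInsert x R).2 with _ | y
    · rw [tableauInsert_cons_of_none T hy, ← rowInsert_of_eq_none hy,
        tableauInsert_cons_of_some T h1]
      simp
    · rw [tableauInsert_cons_of_some T hy, tableauInsert_cons_of_some _ h1]
      simpa using ih (h2 y hy)

/-! ### Shapes -/

/-- The list of row lengths. -/
def shape (T : List (List ℕ)) : List ℕ := T.map List.length

/-- The row lengths after a cell is added to the row of index `i`. -/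
def shapeAdd : ℕ → List ℕ → List ℕ
  | _, [] => [1]
  | 0, a :: s => (a + 1) :: s
  | i + 1, a :: s => a :: shapeAdd i s

lemma shape_addCell (a r : ℕ) (T : List (List ℕ)) :
    shape (addCell a r T) = shapeAdd r (shape T) := by
  induction T generalizing r with
  | nil => cases r <;> simp [addCell, shape, shapeAdd]
  | cons R T ih =>
    cases r with
    | zero => simp [addCell, shape, shapeAdd]
    | succ r => simpa [addCell, shape, shapeAdd] using ih r

lemma shape_tableauInsert (x : ℕ) (T : List (List ℕ)) :
    shape (tableauInsert x T).1 = shapeAdd (tableauInsert x T).2 (shape T) := by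
  induction T generalizing x with
  | nil => simp [tableauInsert, shape, shapeAdd]
  | cons R T ih =>
    rcases h : (rowInsert x R).2 with _ | y
    · simp [tableauInsert_cons_of_none T h, shape, shapeAdd]
    · simpa [tableauInsert_cons_of_some T h, shape, shapeAdd,
        rowInsert_length_of_eq_some h] using ih y

lemma IsTableau.pairwise_shape {T : List (List ℕ)} (h : IsTableau T) :
    (shape T).Pairwise (· ≥ ·) := by
  induction T with
  | nil => simp [shape]
  | cons R T ih =>
    have h1 := ih h.2.2.2
    refine List.pairwise_cons.2 ⟨?_, h1⟩
    cases T with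
    | nil => simp
    | cons S T =>
      have h2 := h.2.2.1.length_le
      have h3 := (List.pairwise_cons.1 h1).1
      simp only [List.headD_cons] at h2
      intro b hb
      rcases List.mem_cons.1 hb with rfl | hb
      · exact h2
      · exact (h3 b hb).trans h2

/-- Reverse insertion. -/
lemma exists_tableauInsert_eq {T T₀ : List (List ℕ)} {r : ℕ} (hT : IsTableau T)
    (hT₀ : IsTableau T₀) (hr : r ≤ T₀.length) (h : shape T = shapeAdd r (shape T₀)) :
    ∃ x U, IsTableau U ∧ shape U = shape T₀ ∧ tableauInsert x U = (T, r) := by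
  induction T generalizing T₀ r with
  | nil => cases T₀ <;> cases r <;> simp [shape, shapeAdd] at h
  | cons R T ih =>
    obtain ⟨h1, h2, h3, h4⟩ := hT
    cases T₀ with
    | nil =>
      simp only [shape, shapeAdd, List.map_cons, List.map_nil, List.cons.injEq,
        List.map_eq_nil_iff] at h
      obtain ⟨x, rfl⟩ := List.length_eq_one_iff.1 h.1
      obtain ⟨-, rfl⟩ := h
      simp only [List.length_nil, Nat.le_zero] at hr
      subst hr
      exact ⟨x, [], by simp, rfl, rfl⟩
    | cons R₀ T₀ =>
      cases r with
      | zero =>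
        simp only [shape, shapeAdd, List.map_cons, List.cons.injEq] at h
        obtain ⟨U, x, rfl⟩ : ∃ U x, R = U ++ [x] :=
          ⟨_, _, (List.dropLast_append_getLast h1).symm⟩
        simp only [List.length_append, List.length_singleton, Nat.add_right_cancel_iff] at h
        have h5 := List.pairwise_append.1 h2
        -- The letter is the last entry of the first row. Only the shape of `T₀` matters: it ensures
        -- that the shortened row is nonempty and at least as long as the next one.
        refine ⟨x, U :: T, ⟨?_, h5.1, h3.of_append ?_, h4⟩, by simp [shape, h], ?_⟩
        · rintro rfl
          exact hT₀.1 (List.length_eq_zero_iff.1 h.1.symm)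
        · have h6 := hT₀.2.2.1.length_le
          rw [h.1]
          refine le_trans (le_of_eq ?_) h6
          cases T <;> cases T₀ <;> simp_all
        · have h6 := rowInsert_of_forall_le fun b hb => h5.2.2 b hb x (by simp)
          rw [tableauInsert_cons_of_none T (by rw [h6])]
      | succ r =>
        simp only [shape, shapeAdd, List.map_cons, List.cons.injEq] at h
        obtain ⟨y, U, hU, hU', hy⟩ := ih h4 hT₀.2.2.2 (by simpa using hr) h.2
        have hd := headD_tableauInsert y U
        rw [hy] at hd
        simp only at hd
        rw [hd] at h3
        obtain ⟨z, S, hz, hzy⟩ := exists_rowInsert_eq_cons y (U.headD [])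
        cases R with
        | nil => exact absurd rfl h1
        | cons a R =>
          -- The row below begins with some `z ≤ y`, and `a < z` by column strictness; so the first
          -- row has an entry that `y` can eject.
          have hay : a < y := by
            have h3' := h3
            rw [hz] at h3'
            exact h3'.1.trans_le hzy
          obtain ⟨x, V, hV, -, -, hx⟩ := exists_rowInsert_eq_some h2 hay
          have hx2 : (rowInsert x V).2 = some y := by rw [hx]
          refine ⟨x, V :: U, ⟨?_, hV, ?_, hU⟩, ?_, ?_⟩
          · rintro rfl
            simp [rowInsert] at hx
          · refine Dominates.of_rowInsert hV hU.pairwise_headD hx2 ?_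
            rwa [hx]
          · have := rowInsert_length_of_eq_some hx2
            rw [hx] at this
            simp only [shape, List.map_cons, List.cons.injEq]
            exact ⟨by rw [← this, h.1], hU'⟩
          · rw [tableauInsert_cons_of_some U hx2, hy, hx]

/-! ### The recording tableau -/

/-- A cell with label `a` can be added to the row of index `r` of `Q`: no label of `Q` is greater
than `a`, and the labels above the row `r` are less than `a`. -/
def CanAdd (a : ℕ) : ℕ → List (List ℕ) → Prop
  | _, [] => True
  | 0, R :: T => ∀ b ∈ (R :: T).flatten, b ≤ a
  | r + 1, R :: T => (∀ b ∈ R, b < a) ∧ CanAdd a r T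

/-- The greatest label of `Q` is `a`, and `r` is the first row in which it appears. -/
def LastCell (a : ℕ) : ℕ → List (List ℕ) → Prop
  | _, [] => False
  | 0, R :: T => a ∈ R ∧ ∀ b ∈ (R :: T).flatten, b ≤ a
  | r + 1, R :: T => (∀ b ∈ R, b < a) ∧ LastCell a r T

@[simp] lemma canAdd_nil (a r : ℕ) : CanAdd a r [] := by cases r <;> trivial

@[simp] lemma not_lastCell_nil (a r : ℕ) : ¬ LastCell a r [] := by cases r <;> exact id

lemma CanAdd.forall_le {a r : ℕ} {Q : List (List ℕ)} (h : CanAdd a r Q) :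
    ∀ b ∈ Q.flatten, b ≤ a := by
  induction Q generalizing r with
  | nil => simp
  | cons R T ih =>
    cases r with
    | zero => exact h
    | succ r =>
      intro b hb
      rw [List.flatten_cons, List.mem_append] at hb
      rcases hb with hb | hb
      · exact (h.1 b hb).le
      · exact ih h.2 b hb

lemma LastCell.forall_le {a r : ℕ} {Q : List (List ℕ)} (h : LastCell a r Q) :
    ∀ b ∈ Q.flatten, b ≤ a := by
  induction Q generalizing r with
  | nil => simp
  | cons R T ih =>
    cases r with
    | zero => exact h.2
    | succ r =>
      intro b hb
      rw [List.flatten_cons, List.mem_append] at hb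
      rcases hb with hb | hb
      · exact (h.1 b hb).le
      · exact ih h.2 b hb

lemma LastCell.mem {a r : ℕ} {Q : List (List ℕ)} (h : LastCell a r Q) : a ∈ Q.flatten := by
  induction Q generalizing r with
  | nil => exact absurd h (not_lastCell_nil a r)
  | cons R T ih =>
    rw [List.flatten_cons, List.mem_append]
    cases r with
    | zero => exact Or.inl h.1
    | succ r => exact Or.inr (ih h.2)

/-- Label and row of the last step of the algorithm can thus be read off the recording tableau
alone. -/
lemma LastCell.unique {a b r s : ℕ} {Q : List (List ℕ)} (h : LastCell a r Q)
    (h' : LastCell b s Q) : a = b ∧ r = s := by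
  have hab : a = b := le_antisymm (h'.forall_le _ h.mem) (h.forall_le _ h'.mem)
  subst hab
  refine ⟨rfl, ?_⟩
  induction Q generalizing r s with
  | nil => exact absurd h (not_lastCell_nil a r)
  | cons R T ih =>
    cases r <;> cases s
    · rfl
    · exact absurd (h'.1 a h.1) (lt_irrefl _)
    · exact absurd (h.1 a h'.1) (lt_irrefl _)
    · rw [ih h.2 h'.2]

lemma canAdd_of_forall_lt {a : ℕ} (r : ℕ) {Q : List (List ℕ)} (h : ∀ b ∈ Q.flatten, b < a) :
    CanAdd a r Q := by
  induction Q generalizing r with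
  | nil => exact canAdd_nil a _
  | cons R T ih =>
    cases r with
    | zero => exact fun b hb => (h b hb).le
    | succ r => exact ⟨fun b hb => h b (by simp [hb]), ih r fun b hb => h b (by
        rw [List.flatten_cons]; exact List.mem_append_right _ hb)⟩

lemma LastCell.canAdd {a r s : ℕ} {Q : List (List ℕ)} (h : LastCell a r Q) (hs : s ≤ r) :
    CanAdd a s Q := by
  induction Q generalizing r s with
  | nil => exact canAdd_nil a _
  | cons R T ih =>
    cases s with
    | zero => exact h.forall_le
    | succ s =>
      cases r with
      | zero => omega
      | succ r => exact ⟨h.1, ih h.2 (by omega)⟩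

lemma CanAdd.le_of_lastCell {a r s : ℕ} {Q : List (List ℕ)} (h : CanAdd a s Q)
    (h' : LastCell a r Q) : s ≤ r := by
  induction Q generalizing r s with
  | nil => exact absurd h' (not_lastCell_nil a r)
  | cons R T ih =>
    cases s with
    | zero => omega
    | succ s =>
      cases r with
      | zero => exact absurd (h.1 a h'.1) (lt_irrefl _)
      | succ r => simpa using ih h.2 h'.2

lemma CanAdd.lastCell {a r : ℕ} {Q : List (List ℕ)} (h : CanAdd a r Q) (hr : r ≤ Q.length) :
    LastCell a r (addCell a r Q) := by
  induction Q generalizing r with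
  | nil =>
    simp only [List.length_nil, Nat.le_zero] at hr
    subst hr
    simp [addCell, LastCell]
  | cons R T ih =>
    cases r with
    | zero =>
      refine ⟨by simp, fun b hb => ?_⟩
      simp only [List.flatten_cons, List.append_assoc, List.mem_append, List.mem_singleton] at hb
      rcases hb with hb | rfl | hb
      · exact h b (by simp [hb])
      · exact le_rfl
      · exact h b (by rw [List.flatten_cons]; exact List.mem_append_right _ hb)
    | succ r => exact ⟨h.1, ih h.2 (by simpa using hr)⟩

lemma addCell_perm (a r : ℕ) (Q : List (List ℕ)) :
    (addCell a r Q).flatten.Perm (a :: Q.flatten) := by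
  induction Q generalizing r with
  | nil => cases r <;> simp [addCell]
  | cons R T ih =>
    cases r with
    | zero =>
      simp only [addCell, List.flatten_cons]
      rw [← List.cons_append]
      exact (List.perm_append_singleton a R).append_right _
    | succ r =>
      simp only [addCell, List.flatten_cons]
      refine ((ih r).append_left _).trans ?_
      simp

lemma addCell_injective {a r : ℕ} {Q Q' : List (List ℕ)} (hQ : IsTableau Q) (hQ' : IsTableau Q')
    (hr : r ≤ Q.length) (hr' : r ≤ Q'.length) (h : addCell a r Q = addCell a r Q') : Q = Q' := by
  induction Q generalizing r Q' with
  | nil =>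
    simp only [List.length_nil, Nat.le_zero] at hr
    subst hr
    cases Q' with
    | nil => rfl
    | cons R T =>
      cases R with
      | nil => exact absurd rfl hQ'.1
      | cons b R => simp [addCell] at h
  | cons R T ih =>
    cases Q' with
    | nil =>
      simp only [List.length_nil, Nat.le_zero] at hr'
      subst hr'
      cases R with
      | nil => exact absurd rfl hQ.1
      | cons b R => simp [addCell] at h
    | cons R' T' =>
      cases r with
      | zero => simpa [addCell] using h
      | succ r =>
        simp only [addCell, List.cons.injEq] at h
        rw [h.1, ih hQ.2.2.2 hQ'.2.2.2 (by simpa using hr) (by simpa using hr') h.2]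

lemma CanAdd.isTableau {a r : ℕ} {Q : List (List ℕ)} (h : CanAdd a r Q) (hQ : IsTableau Q)
    (hs : (shapeAdd r (shape Q)).Pairwise (· ≥ ·)) : IsTableau (addCell a r Q) := by
  induction Q generalizing r with
  | nil => cases r <;> simp [addCell]
  | cons R T ih =>
    obtain ⟨h1, h2, h3, h4⟩ := hQ
    cases r with
    | zero =>
      refine ⟨by simp, ?_, h3.append _, h4⟩
      rw [List.pairwise_append]
      exact ⟨h2, by simp, fun b hb c hc => by
        rw [List.mem_singleton.1 hc]; exact h b (by simp [hb])⟩
    | succ r =>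
      simp only [shape, List.map_cons, shapeAdd, List.pairwise_cons] at hs
      refine ⟨h1, h2, ?_, ih h.2 h4 hs.2⟩
      cases T with
      | nil =>
        cases R with
        | nil => exact absurd rfl h1
        | cons b R => cases r <;> simpa [addCell] using h.1 b (by simp)
      | cons S T =>
        cases r with
        | zero =>
          -- The new shape is still a partition, so the row above has a cell over the new one.
          refine Dominates.concat h3 h.1 ?_
          have := hs.1 (S.length + 1) (by simp [shapeAdd])
          change S.length < R.length
          omega
        | succ r => exact h3

/-- The last cell of a nonempty recording tableau can be removed. -/
lemma exists_eq_addCell {Q : List (List ℕ)} (hQ : IsTableau Q) (hne : Q ≠ []) :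
    ∃ a r Q₀, Q = addCell a r Q₀ ∧ r ≤ Q₀.length ∧ IsTableau Q₀ ∧ CanAdd a r Q₀ := by
  induction Q with
  | nil => exact absurd rfl hne
  | cons R T ih =>
    obtain ⟨h1, h2, h3, h4⟩ := hQ
    obtain ⟨U, m, rfl⟩ : ∃ U m, R = U ++ [m] :=
      ⟨_, _, (List.dropLast_append_getLast h1).symm⟩
    have h5 := List.pairwise_append.1 h2
    -- The cell to remove ends the topmost row containing the greatest label: this is the first row
    -- if `m` is maximal, and a lower row otherwise.
    by_cases hT : ∀ b ∈ T.flatten, b ≤ m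
    · have h6 : Dominates U (T.headD []) := h3.of_concat fun b hb => hT b (by
        cases T with
        | nil => simp at hb
        | cons S T => rw [List.flatten_cons]; exact List.mem_append_left _ hb)
      -- A tableau has no empty rows, so an emptied first row must disappear; `T`, being dominated
      -- by it, is empty as well.
      by_cases hU : U = []
      · subst hU
        refine ⟨m, 0, [], ?_, by simp, by simp, trivial⟩
        cases T with
        | nil => simp [addCell]
        | cons S T =>
          have := h6.length_le
          have h7 := h4.1
          simp_all
      · refine ⟨m, 0, U :: T, by simp [addCell], by simp, ⟨hU, h5.1, h6, h4⟩, fun b hb => ?_⟩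
        rw [List.flatten_cons, List.mem_append] at hb
        rcases hb with hb | hb
        · exact h5.2.2 b hb m (by simp)
        · exact hT b hb
    · have hT' : T ≠ [] := by
        rintro rfl
        simp at hT
      obtain ⟨a, r, T₀, rfl, hr, hT₀, hc⟩ := ih h4 hT'
      have hma : m < a := by
        by_contra hma
        refine hT fun b hb => ?_
        rcases List.mem_cons.1 ((addCell_perm a r T₀).mem_iff.1 hb) with rfl | hb
        · omega
        · have := hc.forall_le b hb
          omega
      refine ⟨a, r + 1, (U ++ [m]) :: T₀, by simp [addCell], by simpa using hr,
        ⟨h1, h2, ?_, hT₀⟩, ?_, hc⟩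
      · cases T₀ with
        | nil => simp
        | cons S T₀ =>
          cases r with
          | zero => exact Dominates.of_concat_right h3
          | succ r => exact h3
      · intro b hb
        rcases List.mem_append.1 hb with hb | hb
        · exact (h5.2.2 b hb m (by simp)).trans_lt hma
        · simp_all

/-! ### The RSK correspondence on lists of rows -/

/-- The order on the columns of generalized permutations. -/
def ColumnLE (a b : ℕ × ℕ) : Prop := a.1 ≤ b.1 ∧ (a.1 = b.1 → a.2 ≤ b.2)

lemma ColumnLE.trans {a b c : ℕ × ℕ} (h : ColumnLE a b) (h' : ColumnLE b c) : ColumnLE a c := by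
  obtain ⟨h1, h2⟩ := h
  obtain ⟨h3, h4⟩ := h'
  exact ⟨h1.trans h3, fun h => (h2 (by omega)).trans (h4 (by omega))⟩

/-- The algorithm `rsk` applied to an arbitrary list of columns. -/
def rskList (w : List (ℕ × ℕ)) : List (List ℕ) × List (List ℕ) :=
  w.foldl
    (fun PQ c => ((tableauInsert c.2 PQ.1).1, addCell c.1 (tableauInsert c.2 PQ.1).2 PQ.2))
    ([], [])

lemma rsk_eq_rskList (w : GeneralizedPermutation) : rsk w = rskList w.columns := rfl

@[simp] lemma rskList_nil : rskList [] = ([], []) := rfl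

@[simp] lemma rskList_concat (w : List (ℕ × ℕ)) (c : ℕ × ℕ) : rskList (w ++ [c]) =
    ((tableauInsert c.2 (rskList w).1).1,
      addCell c.1 (tableauInsert c.2 (rskList w).1).2 (rskList w).2) := by
  simp [rskList, List.foldl_append]

lemma rskList_perm (w : List (ℕ × ℕ)) :
    (rskList w).1.flatten.Perm (w.map Prod.snd) ∧
      (rskList w).2.flatten.Perm (w.map Prod.fst) := by
  induction w using List.reverseRecOn with
  | nil => simp
  | append_singleton w c ih =>
    simp only [rskList_concat, List.map_append, List.map_cons, List.map_nil]
    exact ⟨(tableauInsert_perm _ _).trans ((ih.1.cons _).trans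
        (List.perm_append_singleton _ _).symm),
      (addCell_perm _ _ _).trans ((ih.2.cons _).trans (List.perm_append_singleton _ _).symm)⟩

lemma shape_rskList (w : List (ℕ × ℕ)) : shape (rskList w).1 = shape (rskList w).2 := by
  induction w using List.reverseRecOn with
  | nil => simp
  | append_singleton w c ih => simp [shape_tableauInsert, shape_addCell, ih]

lemma length_eq_of_shape_eq {T U : List (List ℕ)} (h : shape T = shape U) :
    T.length = U.length := by
  simpa [shape] using congrArg List.length h

lemma isTableau_rskList_fst (w : List (ℕ × ℕ)) : IsTableau (rskList w).1 := by
  induction w using List.reverseRecOn with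
  | nil => simp
  | append_singleton w c ih => simpa using ih.tableauInsert _

/-- A label greater than all previous ones can go anywhere. If the label repeats, the letter weakly
increases, so by the row bumping lemma the new cell is weakly above the previous one, whose row is
the topmost one with that label. -/
lemma canAdd_rskList_and {w : List (ℕ × ℕ)} {c : ℕ × ℕ} (hw : (w ++ [c]).Pairwise ColumnLE) :
    CanAdd c.1 (tableauInsert c.2 (rskList w).1).2 (rskList w).2 ∧
      IsTableau (rskList (w ++ [c])).2 := by
  induction w using List.reverseRecOn generalizing c with
  | nil => cases c; simp [rskList, addCell]
  | append_singleton w d ih =>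
    rw [List.pairwise_append] at hw
    obtain ⟨h1, h2⟩ := ih hw.1
    have hdc : ColumnLE d c := hw.2.2 d (by simp) c (by simp)
    have hlast : LastCell d.1 (tableauInsert d.2 (rskList w).1).2 (rskList (w ++ [d])).2 := by
      rw [rskList_concat]
      refine h1.lastCell ?_
      rw [← length_eq_of_shape_eq (shape_rskList w)]
      exact tableauInsert_snd_le _ _
    have hc : CanAdd c.1 (tableauInsert c.2 (rskList (w ++ [d])).1).2 (rskList (w ++ [d])).2 := by
      rcases hdc.1.lt_or_eq with h | h
      · exact canAdd_of_forall_lt _ fun b hb => (hlast.forall_le b hb).trans_lt h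
      · rw [← h]
        refine hlast.canAdd ?_
        rw [rskList_concat]
        exact tableauInsert_snd_le_of_le (isTableau_rskList_fst w) (hdc.2 h)
    refine ⟨hc, ?_⟩
    rw [rskList_concat (w ++ [d])]
    refine hc.isTableau h2 ?_
    rw [← shape_rskList, ← shape_tableauInsert]
    exact ((isTableau_rskList_fst _).tableauInsert _).pairwise_shape

lemma isTableau_rskList_snd {w : List (ℕ × ℕ)} (hw : w.Pairwise ColumnLE) :
    IsTableau (rskList w).2 := by
  induction w using List.reverseRecOn with
  | nil => simp
  | append_singleton w c ih => exact (canAdd_rskList_and hw).2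

lemma tableauInsert_rskList_snd_le (w : List (ℕ × ℕ)) (x : ℕ) :
    (tableauInsert x (rskList w).1).2 ≤ (rskList w).2.length := by
  rw [← length_eq_of_shape_eq (shape_rskList w)]
  exact tableauInsert_snd_le _ _

lemma lastCell_rskList {w : List (ℕ × ℕ)} {c : ℕ × ℕ} (hw : (w ++ [c]).Pairwise ColumnLE) :
    LastCell c.1 (tableauInsert c.2 (rskList w).1).2 (rskList (w ++ [c])).2 := by
  rw [rskList_concat]
  exact (canAdd_rskList_and hw).1.lastCell (tableauInsert_rskList_snd_le _ _)

/-- The last cell of the recording tableau gives the last label and the row where the last insertion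
ended; that step is undone uniquely in both tableaux. -/
lemma rskList_injective {w w' : List (ℕ × ℕ)} (hw : w.Pairwise ColumnLE)
    (hw' : w'.Pairwise ColumnLE) (h : rskList w = rskList w') : w = w' := by
  induction w using List.reverseRecOn generalizing w' with
  | nil =>
    have := (rskList_perm w').1
    rw [← h] at this
    simpa using this.length_eq.symm
  | append_singleton w c ih =>
    induction w' using List.reverseRecOn with
    | nil =>
      have := (rskList_perm (w ++ [c])).1
      rw [h] at this
      simpa using this.length_eq.symm
    | append_singleton w' c' _ =>
      have h1 := lastCell_rskList hw
      have h2 := lastCell_rskList hw'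
      rw [← h] at h2
      obtain ⟨h3, h4⟩ := h1.unique h2
      simp only [rskList_concat, Prod.mk.injEq] at h
      rw [List.pairwise_append] at hw hw'
      obtain ⟨h5, h6⟩ := tableauInsert_injective (isTableau_rskList_fst w)
        (isTableau_rskList_fst w') (Prod.ext h.1 h4)
      have h7 := h.2
      rw [← h3, ← h4] at h7
      have h8 := addCell_injective (isTableau_rskList_snd hw.1) (isTableau_rskList_snd hw'.1)
        (tableauInsert_rskList_snd_le _ _) (h4 ▸ tableauInsert_rskList_snd_le _ _) h7
      rw [ih hw.1 hw'.1 (Prod.ext h6 h8), Prod.ext h3 h5]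

/-- Remove the last cell of `Q`, reverse the insertion that ended in its row, and induct on the
number of cells. -/
lemma exists_rskList_eq {P Q : List (List ℕ)} (hP : IsTableau P) (hQ : IsTableau Q)
    (h : shape P = shape Q) :
    ∃ w : List (ℕ × ℕ), w.Pairwise ColumnLE ∧ rskList w = (P, Q) := by
  generalize hm : Q.flatten.length = m
  induction m generalizing P Q with
  | zero =>
    have hQ' : Q = [] := by
      cases Q with
      | nil => rfl
      | cons R T =>
        have := hQ.1
        simp_all
    subst hQ'
    have hP' : P = [] := by simpa [shape] using h
    exact ⟨[], by simp, by simp [hP']⟩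
  | succ m ih =>
    have hne : Q ≠ [] := by
      rintro rfl
      simp at hm
    obtain ⟨a, r, Q₀, rfl, hr, hQ₀, hc⟩ := exists_eq_addCell hQ hne
    rw [shape_addCell] at h
    obtain ⟨x, P₀, hP₀, hs, hx⟩ := exists_tableauInsert_eq hP hQ₀ hr h
    have hlen := (addCell_perm a r Q₀).length_eq
    obtain ⟨w, hw, hwPQ⟩ := ih hP₀ hQ₀ hs (by simp only [List.length_cons] at hlen; omega)
    refine ⟨w ++ [(a, x)], ?_, by simp [hwPQ, hx]⟩
    rcases List.eq_nil_or_concat' w with rfl | ⟨w, c, rfl⟩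
    · simp
    have hlast := lastCell_rskList hw
    have hca : ColumnLE c (a, x) := by
      rw [hwPQ] at hlast
      refine ⟨hc.forall_le _ hlast.mem, fun hca => ?_⟩
      -- Were the letters decreasing under equal labels, the last cell would lie strictly below the
      -- previous one, against the choice of the topmost row with that label.
      by_contra hlt
      have h1 := tableauInsert_snd_lt_of_lt (rskList w).1 (not_le.1 hlt)
      simp only at hca
      rw [hca] at hlast
      have h2 := hc.le_of_lastCell hlast
      rw [rskList_concat, Prod.mk.injEq] at hwPQ
      rw [hwPQ.1, hx] at h1
      simp only at h1
      omega
    rw [List.pairwise_append]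
    refine ⟨hw, by simp, fun d hd e he => ?_⟩
    rw [List.mem_singleton.1 he]
    rcases List.mem_append.1 hd with hd | hd
    · exact ((List.pairwise_append.1 hw).2.2 d hd c (by simp)).trans hca
    · rwa [List.mem_singleton.1 hd]

/-! ### Tableaux as fillings of Young diagrams -/

lemma dominates_iff {R S : List ℕ} : Dominates R S ↔
    S.length ≤ R.length ∧ ∀ j < S.length, R.getD j 0 < S.getD j 0 := by
  induction R generalizing S with
  | nil => cases S <;> simp
  | cons a R ih =>
    cases S with
    | nil => simp
    | cons b S =>
      rw [dominates_cons, ih]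
      constructor
      · rintro ⟨h1, h2, h3⟩
        refine ⟨by simpa using h2, fun j hj => ?_⟩
        cases j with
        | zero => simpa using h1
        | succ j => simpa using h3 j (by simpa using hj)
      · rintro ⟨h1, h2⟩
        refine ⟨by simpa using h2 0 (by simp), by simpa using h1, fun j hj => ?_⟩
        simpa using h2 (j + 1) (by simpa using hj)

lemma isTableau_iff {T : List (List ℕ)} : IsTableau T ↔
    (∀ R ∈ T, R ≠ [] ∧ R.Pairwise (· ≤ ·)) ∧
      ∀ i, Dominates (T.getD i []) (T.getD (i + 1) []) := by
  induction T with
  | nil => simp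
  | cons R T ih =>
    rw [isTableau_cons, ih]
    constructor
    · rintro ⟨h1, h2, h3, h4, h5⟩
      refine ⟨by simpa [h1, h2] using h4, fun i => ?_⟩
      cases i with
      | zero => cases T <;> exact h3
      | succ i => simpa using h5 i
    · rintro ⟨h1, h2⟩
      refine ⟨(h1 R (by simp)).1, (h1 R (by simp)).2, ?_, fun S hS => h1 S (by simp [hS]),
        fun i => by simpa using h2 (i + 1)⟩
      have := h2 0
      cases T <;> exact this

lemma rowLen_eq_zero {μ : YoungDiagram} {i : ℕ} (h : μ.colLen 0 ≤ i) : μ.rowLen i = 0 := by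
  by_contra h0
  have h1 := YoungDiagram.mem_iff_lt_rowLen.2 (Nat.pos_of_ne_zero h0)
  have := YoungDiagram.mem_iff_lt_colLen.1 h1
  omega

lemma getD_rowsOf (μ : YoungDiagram) (t : ℕ → ℕ → ℕ) (i : ℕ) :
    (rowsOf μ t).getD i [] = (List.range (μ.rowLen i)).map fun j => t i j := by
  rw [List.getD_eq_getElem?_getD, rowsOf, List.getElem?_map]
  by_cases h : i < μ.colLen 0
  · simp [h]
  · simp [h, rowLen_eq_zero (not_lt.1 h)]

lemma shape_rowsOf (μ : YoungDiagram) (t : ℕ → ℕ → ℕ) : shape (rowsOf μ t) = μ.rowLens := by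
  simp [shape, rowsOf, YoungDiagram.rowLens]

lemma rowsOf_injective {μ ν : YoungDiagram} {t u : ℕ → ℕ → ℕ} (h : rowsOf μ t = rowsOf ν u) :
    μ = ν ∧ ∀ i j, (i, j) ∈ μ → t i j = u i j := by
  have h1 (i : ℕ) := (getD_rowsOf μ t i).symm.trans
    ((congrArg (fun T => T.getD i []) h).trans (getD_rowsOf ν u i))
  have h2 (i : ℕ) : μ.rowLen i = ν.rowLen i := by simpa using congrArg List.length (h1 i)
  refine ⟨?_, fun i j hij => ?_⟩
  · ext ⟨i, j⟩
    simp [YoungDiagram.mem_iff_lt_rowLen, h2]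
  · have h3 := h1 i
    rw [h2, List.map_inj_left] at h3
    refine h3 j ?_
    rw [List.mem_range, ← h2]
    exact YoungDiagram.mem_iff_lt_rowLen.1 hij

/-- The rows of a semistandard Young tableau. -/
lemma isTableau_rowsOf {μ : YoungDiagram} (S : SemistandardYoungTableau μ) :
    IsTableau (rowsOf μ S.entry) := by
  rw [isTableau_iff]
  constructor
  · intro R hR
    simp only [rowsOf, List.mem_map, List.mem_range] at hR
    obtain ⟨i, hi, rfl⟩ := hR
    rw [← YoungDiagram.mem_iff_lt_colLen, YoungDiagram.mem_iff_lt_rowLen] at hi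
    refine ⟨by simpa using hi.ne', ?_⟩
    rw [List.pairwise_map]
    refine List.pairwise_lt_range.imp_of_mem fun {a b} _ hb hab => ?_
    exact S.row_weak' hab (YoungDiagram.mem_iff_lt_rowLen.2 (List.mem_range.1 hb))
  · intro i
    rw [getD_rowsOf, getD_rowsOf, dominates_iff]
    have hle := μ.rowLen_anti i (i + 1) (by omega)
    refine ⟨by simpa using hle, fun j hj => ?_⟩
    simp only [List.length_map, List.length_range] at hj
    have := S.col_strict' (Nat.lt_succ_self i) (YoungDiagram.mem_iff_lt_rowLen.2 hj)
    simpa [List.getD_eq_getElem?_getD, hj, hj.trans_le hle] using this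

lemma IsTableau.exists_rowLens_eq {T : List (List ℕ)} (h : IsTableau T) :
    ∃ μ : YoungDiagram, μ.rowLens = shape T := by
  refine ⟨YoungDiagram.ofRowLens (shape T) h.pairwise_shape.sortedGE,
    YoungDiagram.rowLens_ofRowLens_eq_self ?_⟩
  intro x hx
  obtain ⟨R, hR, rfl⟩ := List.mem_map.1 hx
  exact List.length_pos_of_ne_nil ((isTableau_iff.1 h).1 R hR).1

lemma rowLen_eq_of_rowLens_eq {T : List (List ℕ)} {μ : YoungDiagram}
    (hμ : μ.rowLens = shape T) (i : ℕ) : μ.rowLen i = (T.getD i []).length := by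
  have hl : μ.colLen 0 = T.length := by
    rw [← YoungDiagram.length_rowLens, hμ, shape, List.length_map]
  by_cases h : i < T.length
  · have h1 : i < μ.rowLens.length := by rwa [YoungDiagram.length_rowLens, hl]
    rw [← YoungDiagram.get_rowLens (h := h1)]
    simp [hμ, shape, h]
  · rw [rowLen_eq_zero (by omega)]
    simp [List.getD_eq_getElem?_getD, h]

lemma IsTableau.exists_semistandard {T : List (List ℕ)} (h : IsTableau T) {μ : YoungDiagram}
    (hμ : μ.rowLens = shape T) :
    ∃ S : SemistandardYoungTableau μ, rowsOf μ S.entry = T := by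
  rw [isTableau_iff] at h
  have hlen := rowLen_eq_of_rowLens_eq hμ
  have hstep : ∀ i j, (i + 1, j) ∈ μ →
      (T.getD i []).getD j 0 < (T.getD (i + 1) []).getD j 0 := by
    intro i j hij
    rw [YoungDiagram.mem_iff_lt_rowLen, hlen] at hij
    exact (dominates_iff.1 (h.2 i)).2 j hij
  refine ⟨⟨fun i j => (T.getD i []).getD j 0, ?_, ?_, ?_⟩, ?_⟩
  · intro i j₁ j₂ hj hmem
    rw [YoungDiagram.mem_iff_lt_rowLen, hlen] at hmem
    have hi : i < T.length := by
      by_contra hi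
      simp [List.getD_eq_getElem?_getD, hi] at hmem
    have h1 : (T.getD i []).Pairwise (· ≤ ·) := by
      rw [List.getD_eq_getElem _ _ hi]
      exact (h.1 _ (List.getElem_mem hi)).2
    rw [List.getD_eq_getElem _ _ hmem, List.getD_eq_getElem _ _ (hj.trans hmem)]
    exact List.pairwise_iff_getElem.1 h1 _ _ _ _ hj
  · intro i₁ i₂ j hi hmem
    induction i₂, hi using Nat.le_induction with
    | base => exact hstep i₁ j hmem
    | succ m hm ih =>
      exact (ih (μ.up_left_mem (by omega) le_rfl hmem)).trans (hstep m j hmem)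
  · intro i j hmem
    rw [YoungDiagram.mem_iff_lt_rowLen, hlen] at hmem
    exact List.getD_eq_default _ _ (not_lt.1 hmem)
  · have hl : μ.colLen 0 = T.length := by
      rw [← YoungDiagram.length_rowLens, hμ, shape, List.length_map]
    refine List.ext_getElem (by simp [rowsOf, hl]) fun i h1 h2 => ?_
    simp only [rowsOf, List.getElem_map, List.getElem_range]
    refine List.ext_getElem (by simp [hlen, h2]) fun j h3 h4 => ?_
    simp [h2, h4]

/-! ### Contents of fillings -/

/-- The multiset of the entries of the filling `t` of the cells of `μ`. -/
def content (μ : YoungDiagram) (t : ℕ → ℕ → ℕ) : Multiset ℕ :=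
  μ.cells.val.map fun c => t c.1 c.2

lemma coe_flatten_rowsOf (μ : YoungDiagram) (t : ℕ → ℕ → ℕ) :
    ((rowsOf μ t).flatten : Multiset ℕ) = content μ t := by
  have h1 : ((List.range (μ.colLen 0)).flatMap fun i =>
      (List.range (μ.rowLen i)).map fun j => (i, j) : Multiset (ℕ × ℕ)) = μ.cells.val := by
    refine (Multiset.Nodup.ext ?_ μ.cells.nodup).2 fun c => ?_
    · rw [Multiset.coe_nodup, List.nodup_flatMap]
      refine ⟨fun i _ => List.nodup_range.map fun a b h => by simpa using h, ?_⟩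
      refine List.nodup_range.imp fun {a b} hab => ?_
      intro c hc hc'
      simp only [List.mem_map] at hc hc'
      obtain ⟨j, -, rfl⟩ := hc
      obtain ⟨j', -, h⟩ := hc'
      simp only [Prod.mk.injEq] at h
      exact hab h.1.symm
    · obtain ⟨i, j⟩ := c
      have h2 : (i, j) ∈ μ → i < μ.colLen 0 := fun h =>
        YoungDiagram.mem_iff_lt_colLen.1 (μ.up_left_mem le_rfl (Nat.zero_le j) h)
      simp only [Multiset.mem_coe, List.mem_flatMap, List.mem_map, List.mem_range, Prod.mk.injEq,
        Finset.mem_val, YoungDiagram.mem_cells]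
      constructor
      · rintro ⟨a, ha, b, hb, rfl, rfl⟩
        exact YoungDiagram.mem_iff_lt_rowLen.2 hb
      · intro h
        exact ⟨i, h2 h, j, YoungDiagram.mem_iff_lt_rowLen.1 h, rfl, rfl⟩
  rw [content, ← h1, Multiset.map_coe, Multiset.coe_eq_coe, rowsOf, List.map_flatMap,
    List.flatMap_def]
  simp [Function.comp_def]

lemma card_content (μ : YoungDiagram) (t : ℕ → ℕ → ℕ) : (content μ t).card = μ.card := by
  simp [content]

lemma StandardYoungTableau.content_eq {μ : YoungDiagram} (P : StandardYoungTableau μ) :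
    content μ P.entry = (List.range' 1 μ.card : Multiset ℕ) := by
  refine (Multiset.Nodup.ext ?_ ?_).2 fun a => ?_
  · exact Multiset.Nodup.map_on (fun c hc d hd h => P.bijOn.injOn hc hd h) μ.cells.nodup
  · exact List.nodup_range'
  · have h := Set.ext_iff.1 P.bijOn.image_eq a
    simp only [Set.mem_image, Set.mem_Icc] at h
    simp only [content, Multiset.mem_map, Multiset.mem_coe, List.mem_range'_1]
    refine Iff.trans h ?_
    omega

/-- A semistandard filling by `1, …, m`, each used once, is standard. -/
lemma exists_standard {μ : YoungDiagram} {t : ℕ → ℕ → ℕ} {m : ℕ}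
    (hrow : ∀ {i j₁ j₂ : ℕ}, j₁ < j₂ → (i, j₂) ∈ μ → t i j₁ ≤ t i j₂)
    (hcol : ∀ {i₁ i₂ j : ℕ}, i₁ < i₂ → (i₂, j) ∈ μ → t i₁ j < t i₂ j)
    (hc : content μ t = (List.range' 1 m : Multiset ℕ)) :
    μ.card = m ∧ ∃ P : StandardYoungTableau μ, ∀ i j, (i, j) ∈ μ → P.entry i j = t i j := by
  classical
  have hm : μ.card = m := by
    rw [← card_content μ t, hc]
    simp
  have hnd : (content μ t).Nodup := by
    rw [hc]
    exact List.nodup_range'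
  -- The entries are distinct, which makes the weak increase along rows strict.
  have hinj := Multiset.inj_on_of_nodup_map hnd
  have hmem : ∀ {i₁ i₂ j₁ j₂ : ℕ}, i₁ ≤ i₂ → j₁ ≤ j₂ → (i₂, j₂) ∈ μ → (i₁, j₁) ∈ μ :=
    fun h1 h2 h => μ.up_left_mem h1 h2 h
  refine ⟨hm, ⟨fun i j => if (i, j) ∈ μ then t i j else 0, ?_, ?_, ?_, ?_⟩, ?_⟩
  · refine Set.BijOn.congr (f₁ := fun c => t c.1 c.2) ⟨?_, ?_, ?_⟩ ?_
    · intro c hcμ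
      have h1 : t c.1 c.2 ∈ content μ t := Multiset.mem_map_of_mem _ hcμ
      rw [hc, Multiset.mem_coe, List.mem_range'_1] at h1
      change 1 ≤ t c.1 c.2 ∧ t c.1 c.2 ≤ μ.card
      omega
    · exact fun c hc d hd h => hinj c hc d hd h
    · intro a ha
      have h1 : a ∈ content μ t := by
        rw [hc, Multiset.mem_coe, List.mem_range'_1]
        rw [Set.mem_Icc] at ha
        omega
      obtain ⟨c, h2, h3⟩ := Multiset.mem_map.1 h1
      exact ⟨c, h2, h3⟩
    · rintro ⟨i, j⟩ hij
      have hij' : (i, j) ∈ μ := hij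
      simp [hij']
  · intro i j₁ j₂ hj h
    have h' := hmem le_rfl hj.le h
    simp only [h, h', if_true]
    refine lt_of_le_of_ne (hrow hj h) fun heq => ?_
    have := hinj (i, j₁) h' (i, j₂) h heq
    simp only [Prod.mk.injEq, true_and] at this
    omega
  · intro i₁ i₂ j hi h
    simpa only [h, hmem hi.le le_rfl h, if_true] using hcol hi h
  · intro i j h
    simp [h]
  · intro i j h
    simp [h]

/-! ### Injections -/

lemma map_finRange_succ (n : ℕ) :
    (List.finRange n).map (fun i : Fin n => (i : ℕ) + 1) = List.range' 1 n := by
  refine List.ext_getElem (by simp) fun i h1 h2 => ?_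
  simp [Nat.add_comm]

lemma perm_finRange {k n : ℕ} (f : Fin k ↪ Fin n) :
    ((List.finRange k).map f ++ missing f).Perm (List.finRange n) := by
  rw [List.perm_ext_iff_of_nodup ?_ (List.nodup_finRange n)]
  · intro j
    simp only [missing, List.mem_append, List.mem_map, List.mem_finRange, true_and,
      List.mem_filter, decide_eq_true_eq, iff_true]
    by_cases h : ∃ i, f i = j
    · exact Or.inl h
    · exact Or.inr fun i hi => h ⟨i, hi⟩
  · rw [List.nodup_append]
    refine ⟨(List.nodup_finRange k).map f.injective, (List.nodup_finRange n).filter _, ?_⟩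
    intro a ha b hb hab
    obtain ⟨i, -, rfl⟩ := List.mem_map.1 ha
    simp only [missing, List.mem_filter, decide_eq_true_eq] at hb
    exact hb.2 i hab

lemma map_snd_encode_perm {k n : ℕ} (f : Fin k ↪ Fin n) :
    ((encode f).columns.map Prod.snd).Perm (List.range' 1 n) := by
  have h := (perm_finRange f).map fun j : Fin n => (j : ℕ) + 1
  rw [map_finRange_succ] at h
  simpa [encode, Function.comp_def] using h

lemma length_encode {k n : ℕ} (f : Fin k ↪ Fin n) : (encode f).columns.length = n := by
  simpa using (map_snd_encode_perm f).length_eq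

lemma map_fst_encode {k n : ℕ} (f : Fin k ↪ Fin n) : (encode f).columns.map Prod.fst =
    List.range' 1 k ++ List.replicate (n - k) (k + 1) := by
  have h := length_encode f
  simp only [encode, List.length_append, List.length_map, List.length_finRange] at h
  rw [← map_finRange_succ k]
  simp only [encode, List.map_append, List.map_map, Function.comp_def, List.map_const']
  rw [show n - k = (missing f).length by omega]

lemma encode_injective {k n : ℕ} {f g : Fin k ↪ Fin n}
    (h : (encode f).columns = (encode g).columns) : f = g := by
  have h1 := List.append_inj_left h (by simp)
  rw [List.map_inj_left] at h1
  ext i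
  simpa using h1 i (List.mem_finRange i)

/-- A list of columns with the rows of the array of an injection encodes an injection. -/
lemma exists_encode_eq {k n : ℕ} {w : List (ℕ × ℕ)} (hkn : k ≤ n) (hw : w.Pairwise ColumnLE)
    (h₁ : (w.map Prod.fst).Perm (List.range' 1 k ++ List.replicate (n - k) (k + 1)))
    (h₂ : (w.map Prod.snd).Perm (List.range' 1 n)) :
    ∃ f : Fin k ↪ Fin n, (encode f).columns = w := by
  -- Two sorted rearrangements of the same list coincide.
  have hfst : w.map Prod.fst = List.range' 1 k ++ List.replicate (n - k) (k + 1) := by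
    refine h₁.eq_of_pairwise' (r := (· ≤ ·)) ?_ ?_
    · rw [List.pairwise_map]
      exact hw.imp fun h => h.1
    · rw [List.pairwise_append]
      refine ⟨List.pairwise_le_range', List.pairwise_replicate.2 (Or.inr le_rfl), ?_⟩
      intro a ha b hb
      rw [List.mem_range'_1] at ha
      rw [List.eq_of_mem_replicate hb]
      omega
  have hlen : w.length = n := by simpa using h₂.length_eq
  have hnd : (w.map Prod.snd).Nodup := h₂.nodup_iff.2 List.nodup_range'
  have hsnd : ∀ (i : ℕ) (hi : i < w.length), 1 ≤ w[i].2 ∧ w[i].2 < 1 + n := fun i hi =>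
    List.mem_range'_1.1 (h₂.mem_iff.1 (List.mem_map_of_mem (List.getElem_mem hi)))
  have hlab : ∀ (i : ℕ) (hi : i < w.length), w[i].1 = if i < k then i + 1 else k + 1 := by
    intro i hi
    have h3 : w[i].1 = (w.map Prod.fst)[i]'(by simpa using hi) := by simp
    rw [h3, List.getElem_of_eq hfst, List.getElem_append]
    split_ifs with h4 h5 h5
    · simp [Nat.add_comm]
    · simp at h4; omega
    · simp at h4; omega
    · simp
  have hinj : ∀ (i j : ℕ) (hi : i < w.length) (hj : j < w.length), w[i].2 = w[j].2 → i = j := by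
    intro i j hi hj hij
    refine (List.Nodup.getElem_inj_iff hnd (hi := by simpa using hi) (hj := by simpa using hj)).1 ?_
    simpa using hij
  -- `Fin n` is `[n]` shifted by one, hence the `- 1`; bottom entries are at least 1, so truncated
  -- subtraction loses nothing.
  let f : Fin k ↪ Fin n :=
    { toFun := fun i => ⟨(w[(i : ℕ)]'(by omega)).2 - 1, by have := hsnd i (by omega); omega⟩
      inj' := by
        intro i j hij
        have h3 := hsnd i (by omega)
        have h4 := hsnd j (by omega)
        simp only [Fin.mk.injEq] at hij
        exact Fin.ext (hinj i j (by omega) (by omega) (by omega)) }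
  have hf : ∀ i : Fin k, (f i : ℕ) + 1 = (w[(i : ℕ)]'(by omega)).2 := by
    intro i
    have h3 := hsnd i (by omega)
    change (w[(i : ℕ)]'(by omega)).2 - 1 + 1 = _
    omega
  refine ⟨f, ?_⟩
  -- A value missed by `f` occurs in the bottom line after the first `k` places, hence under the
  -- label `k + 1`. Inclusion is enough, since `encode f` has no repeated column and both lists have
  -- length `n`.
  have hsub : (encode f).columns ⊆ w := by
    intro c hc
    simp only [encode, List.mem_append, List.mem_map, List.mem_finRange, true_and] at hc
    rcases hc with ⟨i, rfl⟩ | ⟨j, hj, rfl⟩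
    · have h3 : ((i : ℕ) + 1, (f i : ℕ) + 1) = w[(i : ℕ)]'(by omega) :=
        Prod.ext (by simp [hlab]) (hf i)
      rw [h3]
      exact List.getElem_mem _
    · have h3 : (j : ℕ) + 1 ∈ w.map Prod.snd := by
        rw [h₂.mem_iff, List.mem_range'_1]
        omega
      obtain ⟨c, hc, hcj⟩ := List.mem_map.1 h3
      obtain ⟨m, hm, rfl⟩ := List.getElem_of_mem hc
      have hmk : ¬ m < k := by
        intro hmk
        simp only [missing, List.mem_filter, decide_eq_true_eq] at hj
        refine hj.2 ⟨m, hmk⟩ (Fin.ext ?_)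
        have := hf ⟨m, hmk⟩
        simp only at this
        omega
      have h4 : (k + 1, (j : ℕ) + 1) = w[m] := Prod.ext (by simp [hlab, hmk]) hcj.symm
      rw [h4]
      exact hc
  have hnd' : (encode f).columns.Nodup :=
    List.Nodup.of_map Prod.snd ((map_snd_encode_perm f).nodup_iff.2 List.nodup_range')
  have hperm : (encode f).columns.Perm w :=
    (List.subperm_of_subset hnd' hsub).perm_of_length_le (by rw [length_encode, hlen])
  refine hperm.eq_of_pairwise ?_ (encode f).sorted hw
  rintro ⟨a, b⟩ ⟨c, d⟩ - - ⟨h3, h4⟩ ⟨h5, h6⟩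
  have h7 : a = c := le_antisymm h3 h5
  exact Prod.ext h7 (le_antisymm (h4 h7) (h6 h7.symm))

/-! ### The correspondence -/

/-- The pair `p` consists of the insertion tableau of `f` and of the recording tableau of `f`
without the cells labelled `k + 1`. -/
def Corresponds {k n : ℕ} (f : Fin k ↪ Fin n) (p : TableauPair k n) : Prop :=
  rowsOf p.lam p.P.entry = (rsk (encode f)).1 ∧
    ∃ S : SemistandardYoungTableau p.lam,
      rowsOf p.lam S.entry = (rsk (encode f)).2 ∧
      (∀ i j : ℕ, (i, j) ∈ p.mu ↔ (i, j) ∈ p.lam ∧ S.entry i j ≠ k + 1) ∧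
      (∀ i j : ℕ, (i, j) ∈ p.mu → p.Q.entry i j = S.entry i j)

lemma StandardYoungTableau.ext_of_mem {μ : YoungDiagram} {P P' : StandardYoungTableau μ}
    (h : ∀ i j, (i, j) ∈ μ → P.entry i j = P'.entry i j) : P = P' := by
  ext i j
  by_cases hij : (i, j) ∈ μ
  · exact h i j hij
  · rw [P.zeros hij, P'.zeros hij]

/-- The lists of rows determine the shape and both fillings, and `mu` is cut out by the label `k +
1`. -/
lemma Corresponds.pair_unique {k n : ℕ} {f : Fin k ↪ Fin n} {p p' : TableauPair k n}
    (h : Corresponds f p) (h' : Corresponds f p') : p = p' := by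
  obtain ⟨h1, S, h2, h3, h4⟩ := h
  obtain ⟨h1', S', h2', h3', h4'⟩ := h'
  obtain ⟨hlam, hP⟩ := rowsOf_injective (h1.trans h1'.symm)
  obtain ⟨-, hS⟩ := rowsOf_injective (h2.trans h2'.symm)
  have hmu : p.mu = p'.mu := by
    ext ⟨i, j⟩
    have hij' : (i, j) ∈ p.lam ↔ (i, j) ∈ p'.lam := by rw [hlam]
    rw [YoungDiagram.mem_cells, YoungDiagram.mem_cells, h3, h3', ← hij']
    exact and_congr_right fun hij => by rw [hS i j hij]
  obtain ⟨lam, mu, c1, c2, st, P, Q⟩ := p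
  obtain ⟨lam', mu', c1', c2', st', P', Q'⟩ := p'
  simp only at hlam hmu
  subst hlam hmu
  obtain rfl : P = P' := StandardYoungTableau.ext_of_mem hP
  obtain rfl : Q = Q' := StandardYoungTableau.ext_of_mem fun i j hij =>
    (h4 i j hij).trans ((hS i j (st.1 hij)).trans (h4' i j hij).symm)
  rfl

/-- The recording tableau is recovered from `Q` by writing `k + 1` in the cells of `lam` outside
`mu`; then RSK is injective. -/
lemma Corresponds.injection_unique {k n : ℕ} {f g : Fin k ↪ Fin n} {p : TableauPair k n}
    (h : Corresponds f p) (h' : Corresponds g p) : f = g := by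
  obtain ⟨h1, S, h2, h3, h4⟩ := h
  obtain ⟨h1', S', h2', h3', h4'⟩ := h'
  have hS : S = S' := by
    refine SemistandardYoungTableau.ext fun i j => ?_
    change S.entry i j = S'.entry i j
    by_cases hlam : (i, j) ∈ p.lam
    · by_cases hmu : (i, j) ∈ p.mu
      · exact (h4 i j hmu).symm.trans (h4' i j hmu)
      · have e1 := mt (fun h => (h3 i j).2 ⟨hlam, h⟩) hmu
        have e2 := mt (fun h => (h3' i j).2 ⟨hlam, h⟩) hmu
        rw [not_not.1 e1, not_not.1 e2]
    · rw [S.zeros' hlam, S'.zeros' hlam]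
  subst hS
  exact encode_injective (rskList_injective (encode f).sorted (encode g).sorted
    (Prod.ext (h1.symm.trans h1') (h2.symm.trans h2')))

lemma exists_pair_corresponds {k n : ℕ} (f : Fin k ↪ Fin n) :
    ∃ p : TableauPair k n, Corresponds f p := by
  have hsort : (encode f).columns.Pairwise ColumnLE := (encode f).sorted
  have htP := isTableau_rskList_fst (encode f).columns
  have htQ := isTableau_rskList_snd hsort
  obtain ⟨lam, hlam⟩ := htP.exists_rowLens_eq
  obtain ⟨SP, hSP⟩ := htP.exists_semistandard hlam
  obtain ⟨SQ, hSQ⟩ := htQ.exists_semistandard (hlam.trans (shape_rskList _))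
  obtain ⟨hpP, hpQ⟩ := rskList_perm (encode f).columns
  have hcP : content lam SP.entry = (List.range' 1 n : Multiset ℕ) := by
    rw [← coe_flatten_rowsOf, hSP, Multiset.coe_eq_coe]
    exact hpP.trans (map_snd_encode_perm f)
  have hcQ : content lam SQ.entry =
      (List.range' 1 k ++ List.replicate (n - k) (k + 1) : List ℕ) := by
    rw [← coe_flatten_rowsOf, hSQ, Multiset.coe_eq_coe, ← map_fst_encode f]
    exact hpQ
  have hle : ∀ i j, SQ.entry i j ≤ k + 1 := by
    intro i j
    by_cases hij : (i, j) ∈ lam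
    · have h1 : SQ.entry i j ∈ content lam SQ.entry :=
        Multiset.mem_map_of_mem (fun c : ℕ × ℕ => SQ.entry c.1 c.2) hij
      rw [hcQ, Multiset.mem_coe, List.mem_append, List.mem_range'_1, List.mem_replicate] at h1
      omega
    · rw [SQ.zeros' hij]
      omega
  -- A lower set because `k + 1` is the greatest label and labels weakly increase to the right and
  -- downwards.
  let mu : YoungDiagram :=
    { cells := lam.cells.filter fun c => SQ.entry c.1 c.2 ≠ k + 1
      isLowerSet := by
        rintro ⟨i₂, j₂⟩ ⟨i₁, j₁⟩ ⟨hi, hj⟩ h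
        simp only [Finset.coe_filter, YoungDiagram.mem_cells, Set.mem_ofPred_eq] at h ⊢
        refine ⟨lam.up_left_mem hi hj h.1, ?_⟩
        have h1 : SQ.entry i₁ j₁ ≤ SQ.entry i₁ j₂ :=
          SQ.row_weak_of_le hj (lam.up_left_mem hi le_rfl h.1)
        have h2 : SQ.entry i₁ j₂ ≤ SQ.entry i₂ j₂ := SQ.col_weak hi h.1
        have h3 := hle i₂ j₂
        omega }
  have hmu : ∀ i j, (i, j) ∈ mu ↔ (i, j) ∈ lam ∧ SQ.entry i j ≠ k + 1 := by
    intro i j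
    rw [← YoungDiagram.mem_cells]
    simp [mu]
  have hcmu : content mu SQ.entry = (List.range' 1 k : Multiset ℕ) := by
    have h1 : content mu SQ.entry = (content lam SQ.entry).filter (· ≠ k + 1) := by
      rw [content, content, Multiset.filter_map]
      rfl
    rw [h1, hcQ, Multiset.filter_coe, List.filter_append, List.filter_eq_self.2,
      List.filter_eq_nil_iff.2, List.append_nil]
    · intro a ha
      simp [List.eq_of_mem_replicate ha]
    · intro a ha
      rw [List.mem_range'_1] at ha
      simp only [ne_eq, decide_eq_true_eq]
      omega
  obtain ⟨hlc, P, hP⟩ := exists_standard SP.row_weak' SP.col_strict' hcP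
  obtain ⟨hmc, Q, hQ⟩ := exists_standard (μ := mu) (t := SQ.entry)
    (fun hj h => SQ.row_weak' hj ((hmu _ _).1 h).1)
    (fun hi h => SQ.col_strict' hi ((hmu _ _).1 h).1) hcmu
  -- A strictly increasing column contains `k + 1` at most once.
  have hstrip : IsHorizontalStrip lam mu := by
    refine ⟨fun c hc => ((hmu c.1 c.2).1 hc).1, fun i₁ i₂ j h1 h2 h3 h4 => ?_⟩
    rw [hmu, not_and_not_right] at h2 h4
    have e1 := h2 h1
    have e2 := h4 h3
    rcases lt_trichotomy i₁ i₂ with h | h | h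
    · have := SQ.col_strict' h h3
      omega
    · exact h
    · have := SQ.col_strict' h h1
      omega
  refine ⟨⟨lam, mu, hlc, hmc, hstrip, P, Q⟩, ?_, SQ, hSQ, hmu, hQ⟩
  rw [rsk_eq_rskList, ← hSP]
  simp only [rowsOf]
  refine List.map_congr_left fun i _ => List.map_congr_left fun j hj => hP i j ?_
  exact YoungDiagram.mem_iff_lt_rowLen.2 (List.mem_range.1 hj)

lemma StandardYoungTableau.entry_le {μ : YoungDiagram} (Q : StandardYoungTableau μ) (i j : ℕ) :
    Q.entry i j ≤ μ.card := by
  by_cases h : (i, j) ∈ μ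
  · exact (Q.bijOn.mapsTo h).2
  · simp [Q.zeros h]

/-- A standard Young tableau as a semistandard one. -/
def StandardYoungTableau.toSemistandard {μ : YoungDiagram} (P : StandardYoungTableau μ) :
    SemistandardYoungTableau μ where
  entry := P.entry
  row_weak' hj h := (P.row_strict hj h).le
  col_strict' := P.col_strict
  zeros' := P.zeros

lemma exists_injection_corresponds {k n : ℕ} (p : TableauPair k n) :
    ∃ f : Fin k ↪ Fin n, Corresponds f p := by
  classical
  obtain ⟨lam, mu, hlam, hmu, ⟨hsub, hstrip⟩, P, Q⟩ := p
  have hkn : k ≤ n := by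
    rw [← hlam, ← hmu]
    exact Finset.card_le_card (YoungDiagram.cells_subset_iff.2 hsub)
  have hQle : ∀ i j, Q.entry i j ≤ k := fun i j => hmu ▸ Q.entry_le i j
  -- The candidate recording tableau. In its columns the strip condition forces any cell above a `k
  -- + 1` to lie in `mu`, where labels are at most `k`.
  let S : SemistandardYoungTableau lam :=
    { entry := fun i j => if (i, j) ∈ mu then Q.entry i j else if (i, j) ∈ lam then k + 1 else 0
      row_weak' := by
        intro i j₁ j₂ hj h
        have h1 := lam.up_left_mem le_rfl hj.le h
        by_cases h2 : (i, j₂) ∈ mu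
        · have h3 := mu.up_left_mem le_rfl hj.le h2
          simpa [h2, h3] using (Q.row_strict hj h2).le
        · have h3 := hQle i j₁
          simp only [h1, h2, h, if_true, if_false]
          split_ifs <;> omega
      col_strict' := by
        intro i₁ i₂ j hi h
        have h1 := lam.up_left_mem hi.le le_rfl h
        by_cases h2 : (i₂, j) ∈ mu
        · have h3 := mu.up_left_mem hi.le le_rfl h2
          simpa [h2, h3] using Q.col_strict hi h2
        · have h3 := hQle i₁ j
          have h4 : (i₁, j) ∈ mu := by
            by_contra h4
            exact hi.ne (hstrip i₁ i₂ j h1 h4 h h2)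
          simp only [h2, h, h4, if_true, if_false]
          omega
      zeros' := by
        intro i j h
        have h1 : (i, j) ∉ mu := fun h1 => h (hsub h1)
        simp [h, h1] }
  have hSmu : ∀ i j, (i, j) ∈ mu → S.entry i j = Q.entry i j := fun i j h => if_pos h
  have hSlam : ∀ i j, (i, j) ∈ lam → (i, j) ∉ mu → S.entry i j = k + 1 := fun i j h h' =>
    (if_neg h').trans (if_pos h)
  have hcS : content lam S.entry =
      (List.range' 1 k ++ List.replicate (n - k) (k + 1) : List ℕ) := by
    have h1 : lam.cells.val = mu.cells.val + (lam.cells \ mu.cells).val := by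
      rw [Finset.sdiff_val]
      exact (add_tsub_cancel_of_le
        (Finset.val_le_iff.2 (YoungDiagram.cells_subset_iff.2 hsub))).symm
    rw [content, h1, Multiset.map_add, ← Multiset.coe_add]
    congr 1
    · have h2 := Q.content_eq
      rw [hmu] at h2
      rw [← h2, content]
      exact Multiset.map_congr rfl fun c hc => hSmu c.1 c.2 hc
    · rw [Multiset.coe_replicate, Multiset.eq_replicate, Multiset.card_map, Finset.card_val,
        Finset.card_sdiff_of_subset (YoungDiagram.cells_subset_iff.2 hsub)]
      refine ⟨by rw [← hlam, ← hmu], fun a ha => ?_⟩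
      obtain ⟨c, hc, rfl⟩ := Multiset.mem_map.1 ha
      have hc' := Finset.mem_sdiff.1 hc
      exact hSlam c.1 c.2 hc'.1 hc'.2
  obtain ⟨w, hw, hrsk⟩ := exists_rskList_eq (isTableau_rowsOf P.toSemistandard)
    (isTableau_rowsOf S) (by rw [shape_rowsOf, shape_rowsOf])
  obtain ⟨hp1, hp2⟩ := rskList_perm w
  rw [hrsk] at hp1 hp2
  obtain ⟨f, rfl⟩ := exists_encode_eq hkn hw
    (by rw [← Multiset.coe_eq_coe, ← hcS, ← coe_flatten_rowsOf, Multiset.coe_eq_coe]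
        exact hp2.symm)
    (by rw [← Multiset.coe_eq_coe, ← hlam, ← P.content_eq, ← coe_flatten_rowsOf,
          Multiset.coe_eq_coe]
        exact hp1.symm)
  refine ⟨f, ?_, S, ?_, fun i j => ⟨fun h => ⟨hsub h, ?_⟩, fun h => ?_⟩, fun i j h =>
    (hSmu i j h).symm⟩
  · rw [rsk_eq_rskList, hrsk]
    rfl
  · rw [rsk_eq_rskList, hrsk]
  · have := hQle i j
    rw [hSmu i j h]
    omega
  · by_contra hij
    exact h.2 (hSlam i j h.1 hij)

end InjRSK

/-! ### The bijection -/

theorem mainTheorem1 (k n : ℕ) :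
    ∃ Φ : (Fin k ↪ Fin n) ≃ InjRSK.TableauPair k n, ∀ f : Fin k ↪ Fin n,
      InjRSK.rowsOf (Φ f).lam (Φ f).P.entry = (InjRSK.rsk (InjRSK.encode f)).1 ∧
      ∃ S : SemistandardYoungTableau (Φ f).lam,
        InjRSK.rowsOf (Φ f).lam S.entry = (InjRSK.rsk (InjRSK.encode f)).2 ∧
        (∀ i j : ℕ, (i, j) ∈ (Φ f).mu ↔ (i, j) ∈ (Φ f).lam ∧ S.entry i j ≠ k + 1) ∧
        (∀ i j : ℕ, (i, j) ∈ (Φ f).mu → (Φ f).Q.entry i j = S.entry i j) := by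
  -- `Corresponds` is total and single-valued in both directions, so it is the graph of a bijection.
  choose Φ hΦ using fun f : Fin k ↪ Fin n => InjRSK.exists_pair_corresponds f
  have hbij : Function.Bijective Φ := by
    refine ⟨fun f g hfg => (hΦ f).injection_unique (hfg ▸ hΦ g), fun p => ?_⟩
    obtain ⟨f, hf⟩ := InjRSK.exists_injection_corresponds p
    exact ⟨f, (hΦ f).pair_unique hf⟩
  exact ⟨Equiv.ofBijective Φ hbij, hΦ⟩
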